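/- **Conventions.** A *simplicial complex* $\Delta$ on a finite set $V$ is a family of subsets of $V$ (its *faces*) closed under taking subsets; $\emptyset$ may be a face, and the void complex (no faces) is allowed. Facets are the inclusion-maximal faces, a vertex is a face $\{v\}$, and $\Delta$ is *pure* if all its facets have the same cardinality. For $I\subseteq V$ put $$\mathrm{del}_\Delta(I)=\{J\in\Delta : I\not\subseteq J\},\qquad \mathrm{star}_\Delta(I)=\{J\in\Delta : I\cup J\in\Delta\},$$ $$\mathrm{link}_\Delta(I)=\{J\in\Delta : I\cup J\in\Delta,\ I\cap J=\emptyset\},$$ $$\mathrm{costar}_\Delta(I)=\{J\in\Delta : J\subseteq F \text{ for some facet } F \text{ of } \Delta \text{ with } I\not\subseteq F\}.$$ A complex is a *simplex* if it consists of all subsets of one set $F\subseteq V$; the void complex also counts as a simplex. A complex is *vertex decomposable* if it is a simplex, or if it is pure and has a vertex $v$ such that $\mathrm{del}_\Delta(\{v\})$ and $\mathrm{link}_\Delta(\{v\})$ are both vertex decomposable. It is *strongly vertex decomposable* if $\mathrm{costar}_\Delta(I)$ and $\mathrm{star}_\Delta(I)$ are vertex decomposable for every face $I$ (including $I=\emptyset$).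 It is *spherical* if it is not void and its geometric realization $\bigcup_{I\in\Delta}\mathrm{conv}\{e_i : i\in I\}\subset\mathbb{R}^V$ is homeomorphic to a sphere $S^{n-1}\subset\mathbb R^n$ for some $n\ge 0$ (with $S^{-1}=\emptyset$). Let $(W,S)$ be a Coxeter system with $S$ finite, $Q=(q_1,\dots,q_r)$ a word in $S$, and $\pi\in W$. The *subword complex* $\mathcal{SC}(Q,\pi)$ is the simplicial complex on $\{1,\dots,r\}$ whose facets are the sets $I$ such that the subword of $Q$ formed by the letters at the positions outside $I$ is a reduced expression of $\pi$. It is of *infinite type* if $W$ is infinite. **Proposition.** The following two statements are equivalent. 1. For every spherical subword complex $\mathcal{SC}(Q,\pi)$ of infinite type and every vertex $\{i\}$ of it, the deletion $\mathrm{del}_{\mathcal{SC}(Q,\pi)}(\{i\})$ is vertex decomposable. 2. Every spherical subword complex $\mathcal{SC}(Q,\pi)$ of infinite type is strongly vertex decomposable. -/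

import Mathlib

universe u v

/-- A simplicial complex on the ground set `V`: a family of finite subsets of `V` (the faces) that
is closed under taking subsets. The empty set is allowed as a face, so that the void complex `⊥`
(no faces at all) and the complex `{∅}` are different. Elements of `V` need not be vertices. -/
abbrev FaceComplex (V : Type*) : Type _ := LowerSet (Finset V)

namespace FaceComplex

variable {V : Type*}

/-- The facets are the faces that are maximal with respect to inclusion. -/
def IsFacet (Δ : FaceComplex V) (F : Finset V) : Prop :=
  Maximal (fun J => J ∈ Δ) F

/-- A complex is pure if all its facets have the same dimension. -/
def IsPure (Δ : FaceComplex V) : Prop :=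
  ∀ F G : Finset V, Δ.IsFacet F → Δ.IsFacet G → F.card = G.card

/-- A simplex: the complex of all subsets of one finite set. The void complex is counted as a
simplex as well. -/
def IsSimplex (Δ : FaceComplex V) : Prop :=
  Δ = ⊥ ∨ ∃ F : Finset V, Δ = LowerSet.Iic F

/-- The deletion of `I`: all faces that do not contain `I`. -/
def deletion (Δ : FaceComplex V) (I : Finset V) : FaceComplex V where
  carrier := {J | J ∈ Δ ∧ ¬ I ⊆ J}
  lower' := fun _ _ hba ha => ⟨Δ.lower hba ha.1, fun h => ha.2 (h.trans hba)⟩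

/-- The costar of `I`: the complex generated by the facets that do not contain `I`. -/
def costar (Δ : FaceComplex V) (I : Finset V) : FaceComplex V where
  carrier := {J | J ∈ Δ ∧ ∃ F : Finset V, Δ.IsFacet F ∧ J ⊆ F ∧ ¬ I ⊆ F}
  lower' := fun _ _ hba ha =>
    ⟨Δ.lower hba ha.1, ha.2.imp fun _ hF => ⟨hF.1, Finset.Subset.trans hba hF.2.1, hF.2.2⟩⟩

section

variable [DecidableEq V]

/-- The star of `I`: all faces whose union with `I` is a face. -/
def star (Δ : FaceComplex V) (I : Finset V) : FaceComplex V where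
  carrier := {J | J ∈ Δ ∧ I ∪ J ∈ Δ}
  lower' := fun _ _ hba ha =>
    ⟨Δ.lower hba ha.1, Δ.lower (Finset.union_subset_union_right hba) ha.2⟩

/-- The link of `I`: all faces of the star of `I` that are disjoint from `I`. -/
def link (Δ : FaceComplex V) (I : Finset V) : FaceComplex V where
  carrier := {J | J ∈ Δ ∧ I ∪ J ∈ Δ ∧ I ∩ J = ∅}
  lower' := fun _ _ hba ha =>
    ⟨Δ.lower hba ha.1, Δ.lower (Finset.union_subset_union_right hba) ha.2.1,
      Finset.subset_empty.mp ((Finset.inter_subset_inter_left hba).trans ha.2.2.subset)⟩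

/-- Vertex decomposable complexes: a simplex, or a pure complex with a vertex whose deletion and
link are both vertex decomposable. -/
inductive VertexDecomposable : FaceComplex V → Prop
  | of_isSimplex (Δ : FaceComplex V) (h : Δ.IsSimplex) : VertexDecomposable Δ
  | of_vertex (Δ : FaceComplex V) (v : V) (hpure : Δ.IsPure) (hv : {v} ∈ Δ)
      (hdel : VertexDecomposable (Δ.deletion {v}))
      (hlink : VertexDecomposable (Δ.link {v})) : VertexDecomposable Δ

/-- Strongly vertex decomposable complexes: the costar and the star of every face (the empty face
included) are vertex decomposable. -/
def StronglyVertexDecomposable (Δ : FaceComplex V) : Prop :=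
  ∀ I : Finset V, I ∈ Δ →
    VertexDecomposable (Δ.costar I) ∧ VertexDecomposable (Δ.star I)

/-- The standard geometric realization in `ℝ^V` (`V` finite): the union over all faces `I` of the
convex hull of the standard basis vectors `e_i`, `i ∈ I`. -/
def realization (Δ : FaceComplex V) : Set (V → ℝ) :=
  ⋃ I ∈ Δ, convexHull ℝ ((fun i : V => (Pi.single i 1 : V → ℝ)) '' (I : Set V))

/-- A complex on a finite ground set is spherical if it is not void and its geometric realization
is homeomorphic to a unit sphere in some `ℝ^n`. For `n = 0` this is the empty sphere of
dimension `-1`, the realization of the complex `{∅}`. -/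
def IsSpherical [Finite V] (Δ : FaceComplex V) : Prop :=
  Δ ≠ ⊥ ∧ ∃ n : ℕ,
    Nonempty (Δ.realization ≃ₜ Metric.sphere (0 : EuclideanSpace ℝ (Fin n)) 1)

end

end FaceComplex

namespace CoxeterSystem

variable {B W : Type*} [Group W] {M : CoxeterMatrix B}

/-- The subword `Q_J` of the word `Q = (q_1, …, q_r)`, consisting of the letters with position in
`J`, in their order. -/
def subword {r : ℕ} (Q : Fin r → B) (J : Finset (Fin r)) : List B :=
  ((List.finRange r).filter (fun i => i ∈ J)).map Q

/-- `ω` is a reduced expression for `w`. -/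
def IsReducedExpression (cs : CoxeterSystem M W) (ω : List B) (w : W) : Prop :=
  cs.IsReduced ω ∧ cs.wordProd ω = w

/-- The subword complex of the word `Q` and the group element `w`: the complex generated by the
sets `I` of positions such that the subword on the complement of `I` is a reduced expression
for `w`. -/
def subwordComplex (cs : CoxeterSystem M W) {r : ℕ} (Q : Fin r → B) (w : W) :
    FaceComplex (Fin r) where
  carrier := {J | ∃ I : Finset (Fin r), J ⊆ I ∧ cs.IsReducedExpression (subword Q Iᶜ) w}
  lower' := fun _ _ hba ha => ha.imp fun _ hI => ⟨Finset.Subset.trans hba hI.1, hI.2⟩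

end CoxeterSystem

/-!
A sphere has no free face: if a maximal face `F` is the only one that contains a face `R ⊂ F`,
pushing `R` into the interior of `F` deforms the identity of the realization into a map that misses
the barycenter of `R`, and then the identity of the sphere would be nullhomotopic. Applied to the
ridges `F \ {v}` this says that every vertex `v` of a spherical complex is shedding, so that
`costar {v} = del {v}`. The costar of a larger face `I ∪ {v}` has deletion `del {v}` and
link `costar I` (taken in the link of `v`) at `v`, so its vertex decomposability follows by
induction on the face.

Stars are never an obstruction. Deleting the last position of a word from a subword complex, or
passing to its link, yields a subword complex of the shortened word; for the deletion this is the
exchange condition. Hence subword complexes are vertex decomposable, a property that passes to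
links and stars.

That the sphere is not contractible is proved with the volume polynomial of Milnor and Rogers. For
a smooth retraction `r` of a ball onto its boundary, the integral of `det (1 + t • D(r - id))` over
the ball is a polynomial in `t`. For small `t ≥ 0` it is the volume of the ball because
`x ↦ x + t • (r x - x)` permutes the ball, but for `t = 1` it vanishes because `r` has constant
norm.
-/

namespace FaceComplex

variable {V : Type*} {Δ : FaceComplex V} {I J F : Finset V} {v w : V}

/-- A vertex `v` is shedding if the deletion of `v` is generated by facets of the whole complex. -/
def IsSheddingVertex (Δ : FaceComplex V) (v : V) : Prop :=
  ∀ J ∈ Δ, v ∉ J → ∃ F, Δ.IsFacet F ∧ J ⊆ F ∧ v ∉ F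

theorem mem_deletion_singleton : J ∈ Δ.deletion {v} ↔ J ∈ Δ ∧ v ∉ J :=
  and_congr_right' (not_congr Finset.singleton_subset_iff)

theorem mem_costar : J ∈ Δ.costar I ↔ J ∈ Δ ∧ ∃ F, Δ.IsFacet F ∧ J ⊆ F ∧ ¬ I ⊆ F :=
  Iff.rfl

theorem singleton_mem_of_mem (hJ : J ∈ Δ) (hv : v ∈ J) : {v} ∈ Δ :=
  Δ.lower (Finset.singleton_subset_iff.mpr hv) hJ

theorem exists_isFacet_superset [Finite V] (hJ : J ∈ Δ) : ∃ F, Δ.IsFacet F ∧ J ⊆ F := by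
  obtain ⟨F, hJF, hF⟩ := (Set.toFinite {K : Finset V | K ∈ Δ}).exists_le_maximal hJ
  exact ⟨F, hF, hJF⟩

theorem IsFacet.eq_of_subset (hF : Δ.IsFacet F) (hJ : J ∈ Δ) (h : F ⊆ J) : F = J :=
  h.antisymm (hF.2 hJ h)

theorem IsSimplex.isPure (h : Δ.IsSimplex) : Δ.IsPure := by
  rcases h with rfl | ⟨S, rfl⟩
  · exact fun F _ hF => absurd hF.1 LowerSet.notMem_bot
  · have eq_of_isFacet {F : Finset V} (hF : IsFacet (LowerSet.Iic S) F) : F = S :=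
      hF.eq_of_subset (LowerSet.mem_Iic_iff.mpr le_rfl) hF.1
    exact fun F G hF hG => congrArg _ ((eq_of_isFacet hF).trans (eq_of_isFacet hG).symm)

theorem isSimplex_of_forall_mem_eq_empty (h : ∀ J ∈ Δ, J = ∅) : Δ.IsSimplex := by
  refine or_iff_not_imp_left.mpr fun hΔ => ⟨∅, SetLike.ext fun J => ?_⟩
  obtain ⟨I, hI⟩ := LowerSet.coe_nonempty.mpr hΔ
  exact ⟨fun hJ => (h J hJ).le, fun hJ => Finset.subset_empty.mp hJ ▸ h I hI ▸ hI⟩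

theorem deletion_singleton_eq_self (h : {v} ∉ Δ) : Δ.deletion {v} = Δ :=
  SetLike.ext fun _ => mem_deletion_singleton.trans
    (and_iff_left_of_imp fun hJ hv => h (singleton_mem_of_mem hJ hv))

theorem costar_empty (Δ : FaceComplex V) : Δ.costar ∅ = ⊥ :=
  SetLike.ext fun J => by simp [mem_costar]

theorem IsFacet.of_costar (h : (Δ.costar I).IsFacet F) : Δ.IsFacet F := by
  obtain ⟨-, G, hG, hFG, hIG⟩ := h.1
  exact h.eq_of_subset ⟨hG.1, G, hG, subset_rfl, hIG⟩ hFG ▸ hG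

theorem IsPure.costar (h : Δ.IsPure) (I : Finset V) : (Δ.costar I).IsPure :=
  fun F G hF hG => h F G hF.of_costar hG.of_costar

theorem IsSheddingVertex.costar_singleton (h : Δ.IsSheddingVertex v) :
    Δ.costar {v} = Δ.deletion {v} := by
  refine SetLike.ext fun J => ?_
  simp only [mem_costar, mem_deletion_singleton, Finset.singleton_subset_iff]
  exact and_congr_right fun hJ => ⟨fun ⟨_, _, hJF, hvF⟩ hvJ => hvF (hJF hvJ), h J hJ⟩

variable [DecidableEq V]

theorem mem_star : J ∈ Δ.star I ↔ I ∪ J ∈ Δ :=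
  and_iff_right_of_imp fun h => Δ.lower Finset.subset_union_right h

theorem mem_link_singleton : J ∈ Δ.link {v} ↔ insert v J ∈ Δ ∧ v ∉ J := by
  change J ∈ Δ ∧ {v} ∪ J ∈ Δ ∧ {v} ∩ J = ∅ ↔ _
  rw [Finset.singleton_union, ← Finset.disjoint_iff_inter_eq_empty, Finset.disjoint_singleton_left]
  exact and_iff_right_of_imp fun h => Δ.lower (Finset.subset_insert v J) h.1

theorem link_singleton_eq_bot (h : {v} ∉ Δ) : Δ.link {v} = ⊥ :=
  SetLike.ext fun J => iff_of_false
    (fun hJ => h (singleton_mem_of_mem (mem_link_singleton.mp hJ).1 (Finset.mem_insert_self v J)))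
    LowerSet.notMem_bot

theorem link_deletion_singleton (Δ : FaceComplex V) (h : v ≠ w) :
    (Δ.deletion {v}).link {w} = (Δ.link {w}).deletion {v} := by
  refine SetLike.ext fun J => ?_
  simp only [mem_link_singleton, mem_deletion_singleton, Finset.mem_insert]
  tauto

theorem link_link_singleton (Δ : FaceComplex V) (h : v ≠ w) :
    (Δ.link {v}).link {w} = (Δ.link {w}).link {v} := by
  refine SetLike.ext fun J => ?_
  simp only [mem_link_singleton, Finset.mem_insert, Finset.insert_comm v w]
  tauto

theorem link_star_insert (Δ : FaceComplex V) (hv : v ∉ I) :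
    (Δ.star (insert v I)).link {v} = (Δ.link {v}).star I :=
  SetLike.ext fun J => by simp [mem_link_singleton, mem_star, hv]

theorem deletion_star_insert (Δ : FaceComplex V) (hv : v ∉ I) :
    (Δ.star (insert v I)).deletion {v} = (Δ.link {v}).star I :=
  SetLike.ext fun J => by simp [mem_deletion_singleton, mem_link_singleton, mem_star, hv]

theorem isFacet_link_singleton_iff : (Δ.link {v}).IsFacet F ↔ Δ.IsFacet (insert v F) ∧ v ∉ F := by
  constructor
  · intro hF
    obtain ⟨hvF, hv⟩ := mem_link_singleton.mp hF.1
    refine ⟨⟨hvF, fun G hG hFG => ?_⟩, hv⟩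
    obtain ⟨hvG, hFG⟩ := Finset.insert_subset_iff.mp hFG
    have hG' : G.erase v ∈ Δ.link {v} :=
      mem_link_singleton.mpr ⟨by rwa [Finset.insert_erase hvG], Finset.notMem_erase v G⟩
    exact Finset.subset_insert_iff.mpr (hF.2 hG' (Finset.subset_erase.mpr ⟨hFG, hv⟩))
  · rintro ⟨hF, hv⟩
    refine ⟨mem_link_singleton.mpr ⟨hF.1, hv⟩, fun G hG hFG => ?_⟩
    obtain ⟨hG, hvG⟩ := mem_link_singleton.mp hG
    exact (Finset.insert_subset_insert_iff hvG).mp (hF.2 hG (Finset.insert_subset_insert v hFG))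

theorem IsFacet.link_singleton (hF : Δ.IsFacet F) (hv : v ∈ F) :
    (Δ.link {v}).IsFacet (F.erase v) :=
  isFacet_link_singleton_iff.mpr ⟨by rwa [Finset.insert_erase hv], Finset.notMem_erase v F⟩

theorem IsFacet.of_star (h : (Δ.star I).IsFacet F) : Δ.IsFacet F := by
  have hIF : I ⊆ F := by
    have hmem : I ∪ F ∈ Δ.star I := mem_star.mpr (by simpa [← Finset.union_assoc] using h.1.2)
    exact Finset.union_eq_right.mp (h.eq_of_subset hmem Finset.subset_union_right).symm
  refine ⟨h.1.1, fun G hG hFG => h.2 (mem_star.mpr ?_) hFG⟩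
  rwa [Finset.union_eq_right.mpr (hIF.trans hFG)]

theorem IsPure.star (h : Δ.IsPure) (I : Finset V) : (Δ.star I).IsPure :=
  fun F G hF hG => h F G hF.of_star hG.of_star

theorem IsPure.link_singleton (h : Δ.IsPure) (v : V) : (Δ.link {v}).IsPure := by
  intro F G hF hG
  obtain ⟨hF, hvF⟩ := isFacet_link_singleton_iff.mp hF
  obtain ⟨hG, hvG⟩ := isFacet_link_singleton_iff.mp hG
  have hcard := h _ _ hF hG
  rwa [Finset.card_insert_of_notMem hvF, Finset.card_insert_of_notMem hvG,
    Nat.add_right_cancel_iff] at hcard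

theorem IsSimplex.link_singleton (h : Δ.IsSimplex) (v : V) : (Δ.link {v}).IsSimplex := by
  by_cases hv : {v} ∈ Δ
  · obtain rfl | ⟨S, rfl⟩ := h
    · exact absurd hv LowerSet.notMem_bot
    · have hvS : v ∈ S := Finset.singleton_subset_iff.mp hv
      refine Or.inr ⟨S.erase v, SetLike.ext fun J => mem_link_singleton.trans ?_⟩
      simp [Finset.subset_erase, Finset.insert_subset_iff, hvS]
  · exact Or.inl (link_singleton_eq_bot hv)

theorem IsSheddingVertex.link_singleton (h : Δ.IsSheddingVertex w) (hvw : v ≠ w) :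
    (Δ.link {v}).IsSheddingVertex w := by
  intro J hJ hwJ
  obtain ⟨hJ, hvJ⟩ := mem_link_singleton.mp hJ
  obtain ⟨F, hF, hJF, hwF⟩ := h _ hJ (by simp [hvw.symm, hwJ])
  obtain ⟨hvF, hJF⟩ := Finset.insert_subset_iff.mp hJF
  exact ⟨F.erase v, hF.link_singleton hvF, Finset.subset_erase.mpr ⟨hJF, hvJ⟩,
    fun hw => hwF (Finset.mem_of_mem_erase hw)⟩

theorem IsSheddingVertex.deletion_costar_insert (h : Δ.IsSheddingVertex v) (I : Finset V) :
    (Δ.costar (insert v I)).deletion {v} = Δ.deletion {v} := by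
  refine SetLike.ext fun J => ?_
  simp only [mem_deletion_singleton, mem_costar]
  refine and_congr_left fun hvJ => and_iff_left_of_imp fun hJ => ?_
  obtain ⟨F, hF, hJF, hvF⟩ := h J hJ hvJ
  exact ⟨F, hF, hJF, fun hsub => hvF (hsub (Finset.mem_insert_self v I))⟩

theorem link_costar_insert (Δ : FaceComplex V) (hv : v ∉ I) :
    (Δ.costar (insert v I)).link {v} = (Δ.link {v}).costar I := by
  refine SetLike.ext fun J => ?_
  simp only [mem_link_singleton, mem_costar]
  constructor
  · rintro ⟨⟨hJ, F, hF, hJF, hIF⟩, hvJ⟩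
    obtain ⟨hvF, hJF⟩ := Finset.insert_subset_iff.mp hJF
    exact ⟨⟨hJ, hvJ⟩, F.erase v, hF.link_singleton hvF, Finset.subset_erase.mpr ⟨hJF, hvJ⟩,
      fun hsub => hIF (Finset.insert_subset hvF (hsub.trans (Finset.erase_subset v F)))⟩
  · rintro ⟨⟨hJ, hvJ⟩, F, hF, hJF, hIF⟩
    exact ⟨⟨hJ, insert v F, (isFacet_link_singleton_iff.mp hF).1,
      Finset.insert_subset_insert v hJF,
      fun hsub => hIF ((Finset.insert_subset_insert_iff hv).mp hsub)⟩, hvJ⟩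

namespace VertexDecomposable

theorem isPure (h : Δ.VertexDecomposable) : Δ.IsPure := by
  cases h with
  | of_isSimplex _ h => exact h.isPure
  | of_vertex _ _ hpure => exact hpure

theorem of_deletion_of_link (hpure : Δ.IsPure) (hdel : (Δ.deletion {v}).VertexDecomposable)
    (hlink : (Δ.link {v}).VertexDecomposable) : Δ.VertexDecomposable := by
  by_cases hv : {v} ∈ Δ
  · exact .of_vertex Δ v hpure hv hdel hlink
  · rwa [deletion_singleton_eq_self hv] at hdel

theorem link_singleton (h : Δ.VertexDecomposable) (v : V) : (Δ.link {v}).VertexDecomposable := by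
  induction h with
  | of_isSimplex Δ h => exact .of_isSimplex _ (h.link_singleton v)
  | of_vertex Δ w hpure hw hdel hlink ihdel ihlink =>
    obtain rfl | hvw := eq_or_ne v w
    · exact hlink
    · rw [link_deletion_singleton Δ hvw.symm] at ihdel
      rw [link_link_singleton Δ hvw.symm] at ihlink
      exact .of_deletion_of_link (hpure.link_singleton v) ihdel ihlink

theorem star (h : Δ.VertexDecomposable) (I : Finset V) : (Δ.star I).VertexDecomposable := by
  induction I using Finset.induction_on generalizing Δ with
  | empty =>
    have hstar : Δ.star ∅ = Δ := SetLike.ext fun J => by rw [mem_star, Finset.empty_union]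
    rwa [hstar]
  | insert v I hv ih =>
    have hlink := ih (h.link_singleton v)
    exact .of_deletion_of_link (v := v) (h.isPure.star _) (by rwa [deletion_star_insert Δ hv])
      (by rwa [link_star_insert Δ hv])

end VertexDecomposable

theorem vertexDecomposable_costar (hpure : Δ.IsPure) (hshed : ∀ i, {i} ∈ Δ → Δ.IsSheddingVertex i)
    (hdel : ∀ i, {i} ∈ Δ → (Δ.deletion {i}).VertexDecomposable) (hI : I ∈ Δ) :
    (Δ.costar I).VertexDecomposable := by
  induction I using Finset.induction_on generalizing Δ with
  | empty => exact .of_isSimplex _ (Or.inl Δ.costar_empty)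
  | insert v I hv ih =>
    have hvΔ : {v} ∈ Δ := singleton_mem_of_mem hI (Finset.mem_insert_self v I)
    have of_mem_link {i : V} (hi : {i} ∈ Δ.link {v}) : {i} ∈ Δ ∧ v ≠ i := by
      obtain ⟨hiΔ, hvi⟩ := mem_link_singleton.mp hi
      exact ⟨Δ.lower (Finset.subset_insert _ _) hiΔ, by simpa using hvi⟩
    have hlink : ((Δ.link {v}).costar I).VertexDecomposable := by
      refine ih (hpure.link_singleton v) (fun i hi => ?_) (fun i hi => ?_)
        (mem_link_singleton.mpr ⟨hI, hv⟩) <;> obtain ⟨hi, hvi⟩ := of_mem_link hi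
      · exact (hshed i hi).link_singleton hvi
      · exact link_deletion_singleton Δ hvi.symm ▸ (hdel i hi).link_singleton v
    refine .of_deletion_of_link (v := v) (hpure.costar _) ?_ ?_
    · rw [(hshed v hvΔ).deletion_costar_insert]
      exact hdel v hvΔ
    · rwa [link_costar_insert Δ hv]

theorem VertexDecomposable.stronglyVertexDecomposable_iff (h : Δ.VertexDecomposable)
    (hshed : ∀ i, {i} ∈ Δ → Δ.IsSheddingVertex i) :
    Δ.StronglyVertexDecomposable ↔ ∀ i, {i} ∈ Δ → (Δ.deletion {i}).VertexDecomposable :=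
  ⟨fun hstrong i hi => (hshed i hi).costar_singleton ▸ (hstrong {i} hi).1,
    fun hdel I hI => ⟨vertexDecomposable_costar h.isPure hshed hdel hI, h.star I⟩⟩

end FaceComplex

section ExchangeCondition

open CoxeterSystem

variable {B W : Type*} [Group W] {M : CoxeterMatrix B} (cs : CoxeterSystem M W)

open Classical in
/-- The action of a simple reflection `s` on `W × ℤ/2`: conjugation by `s` on the first factor,
with the sign switched at the fixed point `s`. -/
noncomputable def signedConjSimple (i : B) : Equiv.Perm (W × ZMod 2) :=
  Function.Involutive.toPerm
    (fun p => (cs.simple i * p.1 * cs.simple i, p.2 + if p.1 = cs.simple i then 1 else 0))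
    fun p => by
      have hfix : cs.simple i * p.1 * cs.simple i = cs.simple i ↔ p.1 = cs.simple i := by
        rw [mul_assoc, mul_eq_left, mul_eq_one_iff_eq_inv, cs.inv_simple]
      ext
      · simp [mul_assoc]
      · simp only [hfix, add_assoc, CharTwo.add_self_eq_zero, add_zero]

open Classical in
theorem signedConjSimple_apply (i : B) (t : W) (e : ZMod 2) : signedConjSimple cs i (t, e) =
    (cs.simple i * t * cs.simple i, e + if t = cs.simple i then 1 else 0) :=
  rfl

open Classical in
theorem prod_map_signedConjSimple_apply (ω : List B) (t : W) (e : ZMod 2) :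
    (ω.map (signedConjSimple cs)).prod (t, e) =
      (cs.wordProd ω * t * (cs.wordProd ω)⁻¹, e + ((cs.rightInvSeq ω).count t : ZMod 2)) := by
  induction ω with
  | nil => simp
  | cons i ω ih =>
    have hconj : cs.wordProd ω * t * (cs.wordProd ω)⁻¹ = cs.simple i ↔
        (cs.wordProd ω)⁻¹ * cs.simple i * cs.wordProd ω = t := by
      rw [mul_inv_eq_iff_eq_mul, mul_assoc, inv_mul_eq_iff_eq_mul, eq_comm]
    rw [List.map_cons, List.prod_cons, Equiv.Perm.mul_apply, ih, signedConjSimple_apply,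
      cs.wordProd_cons, rightInvSeq, List.count_cons]
    ext
    · simp [mul_assoc]
    · simp only [hconj, beq_iff_eq]
      push_cast
      rw [add_assoc]

theorem prod_map_reverse_alternatingWord {G : Type*} [Monoid G] (f : B → G) (i j : B) (k : ℕ) :
    ((alternatingWord j i (2 * k)).reverse.map f).prod = (f i * f j) ^ k := by
  induction k with
  | zero => simp [alternatingWord]
  | succ k ih =>
    rw [show 2 * (k + 1) = 2 * k + 1 + 1 by ring, alternatingWord_succ, alternatingWord_succ,
      List.concat_eq_append, List.concat_eq_append, List.reverse_append, List.reverse_append,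
      pow_succ', ← ih]
    simp [mul_assoc]

theorem leftInvSeq_alternatingWord (i j : B) (k : ℕ) :
    cs.leftInvSeq (alternatingWord j i (2 * k)) =
      (List.range (2 * k)).map fun l => cs.simple j * (cs.simple i * cs.simple j) ^ l := by
  refine List.ext_getElem (by simp) fun l hl _ => ?_
  rw [length_leftInvSeq, length_alternatingWord] at hl
  have hodd : (2 * l + 1) / 2 = l := by lia
  simp [cs.getElem_leftInvSeq_alternatingWord j i k l hl, cs.prod_alternatingWord_eq_mul_pow, hodd]

theorem isLiftable_signedConjSimple : M.IsLiftable (signedConjSimple cs) := by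
  classical
  intro i j
  have hwordProd : cs.wordProd (alternatingWord j i (2 * M i j)) = 1 := by
    rw [cs.prod_alternatingWord_eq_mul_pow]
    simp
  rw [← prod_map_reverse_alternatingWord]
  ext1 ⟨t, e⟩
  have heven : Even ((cs.leftInvSeq (alternatingWord j i (2 * M i j))).count t) := by
    rw [leftInvSeq_alternatingWord, two_mul, List.range_add, List.map_append, List.map_map,
      List.count_append]
    simp only [Function.comp_def, pow_add, cs.simple_mul_simple_pow, one_mul, Even.add_self]
  rw [prod_map_signedConjSimple_apply, cs.wordProd_reverse, hwordProd, cs.rightInvSeq_reverse,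
    List.count_reverse, (ZMod.natCast_eq_zero_iff_even).mpr heven]
  simp

/-- The action of a Coxeter group on `W × ℤ/2` by conjugation with signs. The sign at `t` of the
action of a word counts, modulo 2, how often `t` occurs in its right inversion sequence, so this
parity depends on the product of the word only. -/
noncomputable def signedConj : W →* Equiv.Perm (W × ZMod 2) :=
  cs.lift ⟨signedConjSimple cs, isLiftable_signedConjSimple cs⟩

open Classical in
theorem signedConj_wordProd_apply (ω : List B) (t : W) (e : ZMod 2) :
    signedConj cs (cs.wordProd ω) (t, e) =
      (cs.wordProd ω * t * (cs.wordProd ω)⁻¹, e + ((cs.rightInvSeq ω).count t : ZMod 2)) := by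
  have hsimple : signedConj cs ∘ cs.simple = signedConjSimple cs :=
    funext fun i => cs.lift_apply_simple _ i
  rw [← prod_map_signedConjSimple_apply, wordProd, map_list_prod, List.map_map, hsimple]

theorem simple_mem_rightInvSeq_of_isRightDescent {ω : List B} {i : B}
    (h : cs.IsRightDescent (cs.wordProd ω) i) : cs.simple i ∈ cs.rightInvSeq ω := by
  classical
  obtain ⟨ω', hω', hprod⟩ := cs.exists_isReduced (cs.wordProd ω * cs.simple i)
  have hconcat : cs.wordProd (ω'.concat i) = cs.wordProd ω := by
    rw [cs.wordProd_concat, ← hprod, cs.simple_mul_simple_cancel_right]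
  have hred : cs.IsReduced (ω'.concat i) := by
    rw [CoxeterSystem.IsReduced, hconcat, List.length_concat, ← hω'.eq, ← hprod]
    exact (cs.isRightDescent_iff.mp h).symm
  have hcount : (cs.rightInvSeq (ω'.concat i)).count (cs.simple i) = 1 :=
    List.count_eq_one_of_mem hred.nodup_rightInvSeq (by rw [cs.rightInvSeq_concat]; simp)
  have hparity : ((cs.rightInvSeq ω).count (cs.simple i) : ZMod 2) = 1 := by
    have hsign := signedConj_wordProd_apply cs (ω'.concat i) (cs.simple i) 0
    rw [hconcat, signedConj_wordProd_apply, hcount] at hsign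
    simpa using congrArg Prod.snd hsign
  by_contra hmem
  rw [List.count_eq_zero_of_not_mem hmem] at hparity
  exact absurd hparity (by decide)

theorem exists_wordProd_append_eq_mul_simple {ω : List B} {i : B}
    (h : cs.IsRightDescent (cs.wordProd ω) i) :
    ∃ (ω₁ : List B) (j : B) (ω₂ : List B), ω = ω₁ ++ j :: ω₂ ∧
      cs.wordProd (ω₁ ++ ω₂) = cs.wordProd ω * cs.simple i := by
  obtain ⟨k, hk, hki⟩ := List.mem_iff_getElem.mp (simple_mem_rightInvSeq_of_isRightDescent cs h)
  have hkω : k < ω.length := by simpa using hk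
  refine ⟨ω.take k, ω[k], ω.drop (k + 1), by simp, ?_⟩
  rw [← List.eraseIdx_eq_take_drop_succ, ← cs.wordProd_mul_getD_rightInvSeq,
    List.getD_eq_getElem _ _ hk, hki]

end ExchangeCondition

section SubwordComplex

open CoxeterSystem FaceComplex

variable {B W : Type*} [Group W] {M : CoxeterMatrix B} (cs : CoxeterSystem M W)
  {r : ℕ} (Q : Fin r → B) {A P J : Finset (Fin r)} {a : Fin r} {w : W}

theorem subword_toFinset {l : List (Fin r)} (hl : l.SortedLT) :
    subword Q l.toFinset = l.map Q := by
  have hfilter : ((List.finRange r).filter (· ∈ l.toFinset)).SortedLT :=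
    ((List.sortedLT_finRange r).pairwise.filter _).sortedLT
  have hmem : ((List.finRange r).filter (· ∈ l.toFinset)).toFinset = l.toFinset := by
    ext; simp
  rw [subword, ← (List.toFinset_sort (· ≤ ·) hl.nodup).mpr hl.sortedLE.pairwise, ← hmem,
    (List.toFinset_sort (· ≤ ·) hfilter.nodup).mpr hfilter.sortedLE.pairwise, hmem]

theorem subword_eq_map_sort (A : Finset (Fin r)) : subword Q A = A.sort.map Q := by
  conv_lhs => rw [← A.sort_toFinset (· ≤ ·)]
  exact subword_toFinset Q A.sortedLT_sort

theorem length_subword (A : Finset (Fin r)) : (subword Q A).length = A.card := by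
  rw [subword_eq_map_sort, List.length_map, Finset.length_sort]

theorem subword_insert_of_forall_lt (h : ∀ x ∈ A, x < a) :
    subword Q (insert a A) = subword Q A ++ [Q a] := by
  have hsorted : (A.sort ++ [a]).SortedLT := List.Pairwise.sortedLT <|
    List.pairwise_append.mpr ⟨A.sortedLT_sort.pairwise, List.pairwise_singleton _ _, by simpa⟩
  have hinsert : insert a A = (A.sort ++ [a]).toFinset := by
    ext; simp
  rw [hinsert, subword_toFinset Q hsorted, List.map_append, subword_eq_map_sort,
    List.map_singleton]

theorem exists_subword_erase {Q : Fin r → B} {ω₁ ω₂ : List B} {b : B}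
    (h : subword Q A = ω₁ ++ b :: ω₂) : ∃ x ∈ A, subword Q (A.erase x) = ω₁ ++ ω₂ := by
  rw [subword_eq_map_sort] at h
  obtain ⟨l₁, l, hA, rfl, hl⟩ := List.map_eq_append_iff.mp h
  obtain ⟨x, l₂, rfl, -, rfl⟩ := List.map_eq_cons_iff.mp hl
  have hsorted : (l₁ ++ x :: l₂).SortedLT := hA ▸ A.sortedLT_sort
  have hx : x ∉ l₁ ++ l₂ := (List.nodup_cons.mp (List.nodup_middle.mp hsorted.nodup)).1
  have herase : A.erase x = (l₁ ++ l₂).toFinset := by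
    rw [← A.sort_toFinset (· ≤ ·), hA]
    ext y
    by_cases hyx : y = x <;> simp_all
  refine ⟨x, by rw [← A.mem_sort (· ≤ ·), hA]; simp, ?_⟩
  have hsublist : (l₁ ++ l₂).Sublist (l₁ ++ x :: l₂) := (List.sublist_cons_self x l₂).append_left l₁
  rw [herase, subword_toFinset Q (hsorted.pairwise.sublist hsublist).sortedLT, List.map_append]

theorem isReducedExpression_iff {ω : List B} :
    cs.IsReducedExpression ω w ↔ cs.wordProd ω = w ∧ ω.length = cs.length w := by
  refine and_comm.trans (and_congr_right ?_)
  rintro rfl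
  exact eq_comm

theorem isReducedExpression_append_singleton_iff {ω : List B} {i : B} :
    cs.IsReducedExpression (ω ++ [i]) w ↔
      cs.IsRightDescent w i ∧ cs.IsReducedExpression ω (w * cs.simple i) := by
  simp only [isReducedExpression_iff, cs.wordProd_append, cs.wordProd_singleton,
    List.length_append, List.length_singleton, ← eq_mul_inv_iff_mul_eq, cs.inv_simple,
    cs.isRightDescent_iff]
  constructor
  · rintro ⟨hω, hlen⟩
    have hle := cs.length_wordProd_le ω
    rw [hω] at hle
    have hcases := cs.length_mul_simple w i
    exact ⟨by lia, hω, by lia⟩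
  · rintro ⟨hw, hω, hlen⟩
    exact ⟨hω, by lia⟩

theorem isReducedExpression_subword_insert_iff (h : ∀ x ∈ P, x < a) :
    cs.IsReducedExpression (subword Q (insert a P)) w ↔
      cs.IsRightDescent w (Q a) ∧ cs.IsReducedExpression (subword Q P) (w * cs.simple (Q a)) := by
  rw [subword_insert_of_forall_lt Q h, isReducedExpression_append_singleton_iff]

theorem exists_isReducedExpression_subword_erase {Q : Fin r → B} {i : B}
    (hP : cs.IsReducedExpression (subword Q P) w) (hi : cs.IsRightDescent w i) :
    ∃ x ∈ P, cs.IsReducedExpression (subword Q (P.erase x)) (w * cs.simple i) := by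
  obtain ⟨hprod, hlen⟩ := (isReducedExpression_iff cs).mp hP
  obtain ⟨ω₁, b, ω₂, hω, hexchange⟩ :=
    exists_wordProd_append_eq_mul_simple cs (hprod.symm ▸ hi)
  obtain ⟨x, hx, herase⟩ := exists_subword_erase hω
  refine ⟨x, hx, (isReducedExpression_iff cs).mpr ⟨by rw [herase, hexchange, hprod], ?_⟩⟩
  have hdescent := cs.isRightDescent_iff.mp hi
  rw [length_subword] at hlen ⊢
  rw [Finset.card_erase_of_mem hx]
  lia

/-- The subword complex of the subword of `Q` on the positions in `A`, as a complex on the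
positions of `Q`. Its faces are described through the positions `P` of the reduced expressions
they avoid. -/
def subwordComplexOn (A : Finset (Fin r)) (w : W) : FaceComplex (Fin r) where
  carrier := {J | ∃ P ⊆ A, J ⊆ A \ P ∧ cs.IsReducedExpression (subword Q P) w}
  lower' := fun _ _ hKJ ⟨P, hPA, hJ, hP⟩ => ⟨P, hPA, hKJ.trans hJ, hP⟩

theorem mem_subwordComplexOn : J ∈ subwordComplexOn cs Q A w ↔
    ∃ P ⊆ A, J ⊆ A \ P ∧ cs.IsReducedExpression (subword Q P) w :=
  Iff.rfl

theorem subwordComplexOn_univ : subwordComplexOn cs Q Finset.univ w = cs.subwordComplex Q w := by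
  refine SetLike.ext fun J => ?_
  simp only [mem_subwordComplexOn, Finset.subset_univ, true_and, ← Finset.compl_eq_univ_sdiff]
  exact (compl_surjective (α := Finset (Fin r))).exists.trans (by simp only [compl_compl]; rfl)

theorem isPure_subwordComplexOn : (subwordComplexOn cs Q A w).IsPure := by
  have card_of_isFacet {F : Finset (Fin r)} (hF : (subwordComplexOn cs Q A w).IsFacet F) :
      F.card = A.card - cs.length w := by
    obtain ⟨P, hPA, hFP, hP⟩ := hF.1
    rw [hF.eq_of_subset ⟨P, hPA, subset_rfl, hP⟩ hFP, Finset.card_sdiff_of_subset hPA,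
      ← length_subword Q P, ((isReducedExpression_iff cs).mp hP).2]
  exact fun F G hF hG => (card_of_isFacet hF).trans (card_of_isFacet hG).symm

theorem link_subwordComplexOn_insert (ha : a ∉ A) :
    (subwordComplexOn cs Q (insert a A) w).link {a} = subwordComplexOn cs Q A w := by
  refine SetLike.ext fun J => ?_
  simp only [mem_link_singleton, mem_subwordComplexOn]
  constructor
  · rintro ⟨⟨P, hPA, hJP, hP⟩, haJ⟩
    obtain ⟨haP, hJP⟩ := Finset.insert_subset_iff.mp hJP
    exact ⟨P, by grind, by grind, hP⟩
  · rintro ⟨P, hPA, hJP, hP⟩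
    exact ⟨⟨P, by grind, by grind, hP⟩, by grind⟩

theorem deletion_subwordComplexOn_insert_of_isRightDescent (ha : ∀ x ∈ A, x < a)
    (hw : cs.IsRightDescent w (Q a)) :
    (subwordComplexOn cs Q (insert a A) w).deletion {a} =
      subwordComplexOn cs Q A (w * cs.simple (Q a)) := by
  have haA : a ∉ A := fun h => (ha a h).false
  refine SetLike.ext fun J => ?_
  simp only [mem_deletion_singleton, mem_subwordComplexOn]
  constructor
  · rintro ⟨⟨P, hPA, hJP, hP⟩, haJ⟩
    by_cases haP : a ∈ P
    · have hPA' : P.erase a ⊆ A := Finset.subset_insert_iff.mp hPA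
      rw [← Finset.insert_erase haP,
        isReducedExpression_subword_insert_iff cs Q fun x hx => ha x (hPA' hx)] at hP
      exact ⟨P.erase a, hPA', by grind, hP.2⟩
    · obtain ⟨x, _, hPx⟩ := exists_isReducedExpression_subword_erase cs hP hw
      exact ⟨P.erase x, by grind, by grind, hPx⟩
  · rintro ⟨P, hPA, hJP, hP⟩
    refine ⟨⟨insert a P, Finset.insert_subset_insert a hPA, by grind, ?_⟩, by grind⟩
    exact (isReducedExpression_subword_insert_iff cs Q fun x hx => ha x (hPA hx)).mpr ⟨hw, hP⟩

theorem deletion_subwordComplexOn_insert_of_not_isRightDescent (ha : ∀ x ∈ A, x < a)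
    (hw : ¬ cs.IsRightDescent w (Q a)) :
    (subwordComplexOn cs Q (insert a A) w).deletion {a} = subwordComplexOn cs Q A w := by
  have haA : a ∉ A := fun h => (ha a h).false
  refine SetLike.ext fun J => ?_
  simp only [mem_deletion_singleton, mem_subwordComplexOn]
  constructor
  · rintro ⟨⟨P, hPA, hJP, hP⟩, haJ⟩
    have haP : a ∉ P := by
      intro haP
      have hPA' : P.erase a ⊆ A := Finset.subset_insert_iff.mp hPA
      rw [← Finset.insert_erase haP,
        isReducedExpression_subword_insert_iff cs Q fun x hx => ha x (hPA' hx)] at hP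
      exact hw hP.1
    exact ⟨P, by grind, by grind, hP⟩
  · rintro ⟨P, hPA, hJP, hP⟩
    exact ⟨⟨P, by grind, by grind, hP⟩, by grind⟩

theorem vertexDecomposable_subwordComplexOn (A : Finset (Fin r)) (w : W) :
    (subwordComplexOn cs Q A w).VertexDecomposable := by
  induction A using Finset.induction_on_max generalizing w with
  | empty =>
    exact .of_isSimplex _
      (isSimplex_of_forall_mem_eq_empty fun J ⟨P, _, hJ, _⟩ => by simpa using hJ)
  | insert a A ha ih =>
    refine .of_deletion_of_link (v := a) (isPure_subwordComplexOn cs Q) ?_ ?_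
    · by_cases hw : cs.IsRightDescent w (Q a)
      · rw [deletion_subwordComplexOn_insert_of_isRightDescent cs Q ha hw]
        exact ih _
      · rw [deletion_subwordComplexOn_insert_of_not_isRightDescent cs Q ha hw]
        exact ih _
    · rw [link_subwordComplexOn_insert cs Q fun h => (ha a h).false]
      exact ih _

theorem vertexDecomposable_subwordComplex (w : W) : (cs.subwordComplex Q w).VertexDecomposable :=
  subwordComplexOn_univ cs Q ▸ vertexDecomposable_subwordComplexOn cs Q Finset.univ w

end SubwordComplex

section DetIdAddSmul

open MeasureTheory Polynomial

theorem exists_polynomial_eval_eq_det_one_add_smul {R m : Type*} [CommRing R] [Fintype m]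
    [DecidableEq m] (A : Matrix m m R) :
    ∃ p : R[X], p.natDegree ≤ Fintype.card m ∧ ∀ t, p.eval t = (1 + t • A).det := by
  refine ⟨((X : R[X]) • A.map C + (1 : Matrix m m R).map C).det, natDegree_det_X_add_C_le A 1,
    fun t => ?_⟩
  rw [← coe_evalRingHom, RingHom.map_det]
  congr 1
  ext i j
  by_cases hij : i = j <;> simp [hij, add_comm, mul_comm t]

theorem exists_polynomial_eval_eq_det_id_add_smul {R E : Type*} [CommRing R] [Nontrivial R]
    [AddCommGroup E] [Module R E] [Module.Free R E] [Module.Finite R E] (A : E →ₗ[R] E) :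
    ∃ p : R[X], p.natDegree ≤ Module.finrank R E ∧
      ∀ t, p.eval t = LinearMap.det (.id + t • A) := by
  let b := Module.finBasis R E
  obtain ⟨p, hdeg, hp⟩ := exists_polynomial_eval_eq_det_one_add_smul (LinearMap.toMatrix b b A)
  refine ⟨p, hdeg.trans_eq (Fintype.card_fin _), fun t => ?_⟩
  rw [hp, ← LinearMap.det_toMatrix b, map_add, map_smul, LinearMap.toMatrix_id]

theorem integral_eval_eq_of_forall_mem_infinite {X : Type*} [MeasurableSpace X] {μ : Measure X}
    {p : X → ℝ[X]} {n : ℕ} (hdeg : ∀ x, (p x).natDegree ≤ n)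
    (hint : ∀ t, Integrable (fun x => (p x).eval t) μ) {S : Set ℝ} (hS : S.Infinite) {c : ℝ}
    (hc : ∀ t ∈ S, ∫ x, (p x).eval t ∂μ = c) (t : ℝ) : ∫ x, (p x).eval t ∂μ = c := by
  obtain ⟨T, hTS, hT⟩ := hS.exists_subset_card_eq (n + 1)
  have heval (x : X) : (p x).eval t = ∑ s ∈ T, (p x).eval s * (Lagrange.basis T id s).eval t := by
    have hdegT : (p x).degree < T.card :=
      degree_le_natDegree.trans_lt (by exact_mod_cast (hdeg x).trans_lt (by lia))
    conv_lhs => rw [Lagrange.eq_interpolate (v := id) Function.injective_id.injOn hdegT]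
    simp [Lagrange.interpolate_apply, eval_finsetSum]
  calc ∫ x, (p x).eval t ∂μ
      = ∑ s ∈ T, (∫ x, (p x).eval s ∂μ) * (Lagrange.basis T id s).eval t := by
        simp_rw [heval, integral_finsetSum T fun s _ => (hint s).mul_const _, integral_mul_const]
    _ = c * (∑ s ∈ T, Lagrange.basis T id s).eval t := by
        rw [eval_finsetSum, Finset.mul_sum]
        exact Finset.sum_congr rfl fun s hs => by rw [hc s (hTS hs)]
    _ = c := by
        rw [Lagrange.sum_basis Function.injective_id.injOn (Finset.card_pos.mp (by simp [hT])),
          eval_one, mul_one]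

variable {E : Type*} [NormedAddCommGroup E] [NormedSpace ℝ E] [FiniteDimensional ℝ E]

theorem integral_det_id_add_smul_eq_of_forall_mem_infinite {X : Type*} [MeasurableSpace X]
    {μ : Measure X} {A : X → E →L[ℝ] E}
    (hint : ∀ t : ℝ, Integrable (fun x => (.id ℝ E + t • A x).det) μ)
    {S : Set ℝ} (hS : S.Infinite) {c : ℝ} (hc : ∀ t ∈ S, ∫ x, (.id ℝ E + t • A x).det ∂μ = c)
    (t : ℝ) : ∫ x, (.id ℝ E + t • A x).det ∂μ = c := by
  choose p hdeg hp using fun x => exists_polynomial_eval_eq_det_id_add_smul (A x : E →ₗ[ℝ] E)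
  have hp' (t : ℝ) (x : X) : (.id ℝ E + t • A x).det = (p x).eval t := (hp x t).symm
  simp only [hp'] at hint hc ⊢
  exact integral_eval_eq_of_forall_mem_infinite hdeg hint hS hc t

theorem det_id_add_ne_zero {A : E →L[ℝ] E} (hA : ‖A‖ < 1) : (.id ℝ E + A).det ≠ 0 := by
  intro hdet
  obtain ⟨v, hv, hv0⟩ := (Submodule.ne_bot_iff _).mp (LinearMap.bot_lt_ker_of_det_eq_zero hdet).ne'
  have hAv : v = -A v := eq_neg_of_add_eq_zero_left (by simpa using hv)
  refine lt_irrefl ‖v‖ ?_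
  calc ‖v‖ = ‖A v‖ := (congrArg norm hAv).trans (norm_neg _)
    _ ≤ ‖A‖ * ‖v‖ := A.le_opNorm v
    _ < ‖v‖ := mul_lt_of_lt_one_left (norm_pos_iff.mpr hv0) hA

theorem det_id_add_pos {A : E →L[ℝ] E} (hA : ‖A‖ < 1) : 0 < (.id ℝ E + A).det := by
  have hcont : Continuous fun s : ℝ => (.id ℝ E + s • A).det :=
    ContinuousLinearMap.continuous_det.comp (by fun_prop)
  by_contra! hle
  obtain ⟨s, hs, hs0⟩ := intermediate_value_Icc' zero_le_one hcont.continuousOn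
    (show (0 : ℝ) ∈ _ from ⟨by simpa using hle, by simp [ContinuousLinearMap.det]⟩)
  refine det_id_add_ne_zero ?_ hs0
  calc ‖s • A‖ = s * ‖A‖ := by rw [norm_smul, Real.norm_of_nonneg hs.1]
    _ ≤ ‖A‖ := mul_le_of_le_one_left (norm_nonneg A) hs.2
    _ < 1 := hA

theorem mapsTo_ball_add_smul_sub {E : Type*} [SeminormedAddCommGroup E] [NormedSpace ℝ E] {R : ℝ}
    {r : E → E} (hr : ∀ x, ‖r x‖ ≤ R) {t : ℝ} (ht₀ : 0 ≤ t) (ht₁ : t < 1) :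
    Set.MapsTo (fun x => x + t • (r x - x)) (Metric.ball 0 R) (Metric.ball 0 R) := by
  intro x hx
  rw [mem_ball_zero_iff] at hx ⊢
  calc ‖x + t • (r x - x)‖ = ‖(1 - t) • x + t • r x‖ := by congr 1; module
    _ ≤ (1 - t) * ‖x‖ + t * ‖r x‖ := by
      refine (norm_add_le _ _).trans_eq ?_
      rw [norm_smul, norm_smul, Real.norm_of_nonneg ht₀, Real.norm_of_nonneg (by linarith)]
    _ < R := by nlinarith [hr x]

theorem injOn_and_image_eq_of_approximatesLinearOn_id {U : Set E} (hU : IsOpen U)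
    (hconn : IsPreconnected U) (hne : U.Nonempty) (hbdd : Bornology.IsBounded U) {f : E → E}
    {c : NNReal} (hc : c < 1) (hf : ApproximatesLinearOn f (.id ℝ E) (closure U) c)
    (hmaps : Set.MapsTo f U U) (hfix : ∀ x ∈ frontier U, f x = x) :
    Set.InjOn f U ∧ f '' U = U := by
  let e := ContinuousLinearEquiv.refl ℝ E
  have hfU : ApproximatesLinearOn f (e : E →L[ℝ] E) U c := hf.mono_set subset_closure
  have hc' : Subsingleton E ∨ c < ‖(e.symm : E →L[ℝ] E)‖₊⁻¹ := by
    obtain _ | _ := subsingleton_or_nontrivial E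
    · exact .inl ‹_›
    · have hnorm : ‖(e.symm : E →L[ℝ] E)‖₊ = 1 := ContinuousLinearMap.nnnorm_id
      exact .inr (by rwa [hnorm, inv_one])
  refine ⟨hfU.injOn hc', hmaps.image_subset.antisymm ?_⟩
  have hopen : IsOpen (f '' U) := hfU.open_image e.toNonlinearRightInverse hU hc'
  have hcompact : IsCompact (f '' closure U) :=
    hbdd.isCompact_closure.image_of_continuousOn hf.continuousOn
  obtain ⟨x₀, hx₀⟩ := hne
  refine hconn.subset_of_closure_inter_subset hopen ⟨f x₀, hmaps hx₀, x₀, hx₀, rfl⟩ ?_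
  rintro y ⟨hy, hyU⟩
  obtain ⟨x, hx, rfl⟩ := closure_minimal (Set.image_mono subset_closure) hcompact.isClosed hy
  by_cases hxU : x ∈ U
  · exact ⟨x, hxU, rfl⟩
  · rw [hfix x (hU.frontier_eq ▸ ⟨hx, hxU⟩)] at hyU
    exact absurd hyU hxU

/- Change of variables: `x ↦ x + t • φ x` permutes `U`, and its derivative has positive
determinant. -/
theorem setIntegral_det_id_add_smul_eq_measureReal [MeasurableSpace E] [BorelSpace E]
    (μ : Measure E) [μ.IsAddHaarMeasure] {U : Set E} (hU : IsOpen U) (hconn : IsPreconnected U)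
    (hne : U.Nonempty) (hbdd : Bornology.IsBounded U) {φ : E → E} {φ' : E → E →L[ℝ] E} {K : NNReal}
    (hφ' : ∀ x ∈ U, HasFDerivAt φ (φ' x) x) (hK : LipschitzOnWith K φ (closure U))
    (hφ : ∀ x ∈ frontier U, φ x = 0) {t : ℝ} (ht : 0 ≤ t) (htK : t * K < 1)
    (hmaps : Set.MapsTo (fun x => x + t • φ x) U U) :
    ∫ x in U, (.id ℝ E + t • φ' x).det ∂μ = μ.real U := by
  have happrox : ApproximatesLinearOn (fun x => x + t • φ x) (.id ℝ E) (closure U)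
      (t.toNNReal * K) := fun x hx y hy => calc
    _ = ‖t • (φ x - φ y)‖ := by
      rw [ContinuousLinearMap.id_apply]
      congr 1
      module
    _ ≤ t * (K * ‖x - y‖) := by
      rw [norm_smul, Real.norm_of_nonneg ht]
      exact mul_le_mul_of_nonneg_left (hK.norm_sub_le hx hy) ht
    _ = _ := by rw [NNReal.coe_mul, Real.coe_toNNReal t ht, mul_assoc]
  have hlt : t.toNNReal * K < 1 := by
    rwa [← NNReal.coe_lt_coe, NNReal.coe_mul, Real.coe_toNNReal t ht]
  obtain ⟨hinj, himage⟩ := injOn_and_image_eq_of_approximatesLinearOn_id hU hconn hne hbdd hlt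
    happrox hmaps fun x hx => by rw [hφ x hx, smul_zero, add_zero]
  have hpos (x : E) (hx : x ∈ U) : 0 < (.id ℝ E + t • φ' x).det := by
    refine det_id_add_pos ?_
    rw [norm_smul, Real.norm_of_nonneg ht]
    exact (mul_le_mul_of_nonneg_left ((hφ' x hx).le_of_lipschitzOn
      (Filter.mem_of_superset (hU.mem_nhds hx) subset_closure) hK) ht).trans_lt htK
  calc ∫ x in U, (.id ℝ E + t • φ' x).det ∂μ
      = ∫ x in U, |(.id ℝ E + t • φ' x).det| • (1 : ℝ) ∂μ :=
        setIntegral_congr_fun hU.measurableSet fun x hx => by simp [abs_of_pos (hpos x hx)]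
    _ = ∫ _ in (fun x => x + t • φ x) '' U, 1 ∂μ :=
        (integral_image_eq_integral_abs_det_fderiv_smul μ hU.measurableSet (fun x hx =>
          ((hasFDerivAt_id x).add ((hφ' x hx).const_smul t)).hasFDerivWithinAt) hinj
          fun _ => 1).symm
    _ = μ.real U := by simp [himage]

end DetIdAddSmul

section Retraction

open MeasureTheory Metric

variable {E : Type*} [NormedAddCommGroup E] [InnerProductSpace ℝ E]

theorem det_eq_zero_of_hasFDerivAt_of_norm_eq [FiniteDimensional ℝ E] {f : E → E} {f' : E →L[ℝ] E}
    {x : E} (hf : HasFDerivAt f f' x) {R : ℝ} (hR : R ≠ 0) (hnorm : ∀ y, ‖f y‖ = R) :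
    f'.det = 0 := by
  by_contra hdet
  obtain ⟨u, hu⟩ := (LinearMap.equivOfDetNeZero _ hdet).surjective (f x)
  have hu' : f' u = f x := hu
  have hsq := hf.norm_sq
  simp only [hnorm] at hsq
  have horth := congrArg (fun L => L u) (hsq.unique (hasFDerivAt_const (R ^ 2) x))
  simp [hu', hnorm, hR] at horth

theorem not_exists_contDiff_retraction [FiniteDimensional ℝ E] {R : ℝ} (hR : 0 < R) :
    ¬ ∃ r : E → E, ContDiff ℝ 1 r ∧ (∀ x, ‖r x‖ = R) ∧ ∀ x, ‖x‖ = R → r x = x := by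
  rintro ⟨r, hr, hnorm, hfix⟩
  borelize E
  have hφ : ContDiff ℝ 1 fun x => r x - x := hr.sub contDiff_id
  set φ' : E → E →L[ℝ] E := fderiv ℝ fun x => r x - x
  have hφ' (x : E) : HasFDerivAt (fun x => r x - x) (φ' x) x :=
    (hφ.differentiable one_ne_zero x).hasFDerivAt
  obtain ⟨K, hK⟩ := hφ.contDiffOn.exists_lipschitzOnWith (s := closedBall (0 : E) R) one_ne_zero
    (convex_closedBall 0 R) (isCompact_closedBall 0 R)
  have hvol (t : ℝ) (ht : t ∈ Set.Ioo 0 (1 / (K + 1 : ℝ))) :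
      ∫ x in ball (0 : E) R, (.id ℝ E + t • φ' x).det = volume.real (ball (0 : E) R) := by
    have htK : t * (K + 1) < 1 := (lt_div_iff₀ (by positivity)).mp ht.2
    have ht₁ : t < 1 := by nlinarith [ht.1, K.2]
    refine setIntegral_det_id_add_smul_eq_measureReal volume isOpen_ball
      (convex_ball 0 R).isPreconnected (nonempty_ball.mpr hR) isBounded_ball (fun x _ => hφ' x)
      (hK.mono closure_ball_subset_closedBall) (fun x hx => ?_) ht.1.le (by linarith [ht.1])
      (mapsTo_ball_add_smul_sub (fun x => (hnorm x).le) ht.1.le ht₁)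
    exact sub_eq_zero.mpr (hfix x (mem_sphere_zero_iff_norm.mp (frontier_ball_subset_sphere hx)))
  have hint (t : ℝ) : IntegrableOn (fun x => (.id ℝ E + t • φ' x).det) (ball 0 R) :=
    (ContinuousLinearMap.continuous_det.comp (by fun_prop)).continuousOn.integrableOn_compact
      (isCompact_closedBall 0 R) |>.mono_set ball_subset_closedBall
  have hzero (x : E) : (.id ℝ E + (1 : ℝ) • φ' x).det = 0 := by
    refine det_eq_zero_of_hasFDerivAt_of_norm_eq (f := r) (x := x) ?_ hR.ne' hnorm
    rw [one_smul]
    exact ((hasFDerivAt_id x).add (hφ' x)).congr_of_eventuallyEq (.of_forall fun y => by simp)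
  have hone := integral_det_id_add_smul_eq_of_forall_mem_infinite hint
    (Set.Ioo_infinite (by positivity)) hvol 1
  simp only [hzero, integral_zero] at hone
  exact hone.not_lt (ENNReal.toReal_pos (measure_ball_pos _ _ hR).ne' measure_ball_lt_top.ne)

end Retraction

section Sphere

open Metric NormedSpace

section

variable {E : Type*} [NormedAddCommGroup E] [NormedSpace ℝ E]

open Classical in
/-- The radial projection of a normed space onto its unit sphere. It takes an arbitrary prescribed
value `p` at the origin, so that it is defined everywhere. -/
noncomputable def radialProjection (p : sphere (0 : E) 1) (x : E) : sphere (0 : E) 1 :=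
  if hx : x = 0 then p else ⟨normalize x, by simpa using hx⟩

theorem coe_radialProjection (p : sphere (0 : E) 1) {x : E} (hx : x ≠ 0) :
    (radialProjection p x : E) = normalize x := by
  simp [radialProjection, hx]

theorem continuousOn_radialProjection (p : sphere (0 : E) 1) :
    ContinuousOn (radialProjection p) {0}ᶜ := by
  rw [continuousOn_iff_continuous_domRestrict, Topology.IsInducing.subtypeVal.continuous_iff]
  have hrestrict : Subtype.val ∘ Set.domRestrict {0}ᶜ (radialProjection p) =
      fun x : ({0}ᶜ : Set E) => ‖(x : E)‖⁻¹ • (x : E) :=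
    funext fun x => coe_radialProjection p x.2
  rw [hrestrict]
  exact (continuous_subtype_val.norm.inv₀ fun x => norm_ne_zero_iff.mpr x.2).smul
    continuous_subtype_val

/-- The extension to the whole space of the nullhomotopy `H` of the identity of the unit sphere: it
runs through `H` on the spheres of radius between `1` and `1 / 2`, and it is the identity outside
the unit ball. -/
noncomputable def nullhomotopyExtension {p : sphere (0 : E) 1}
    (H : (ContinuousMap.id (sphere (0 : E) 1)).Homotopy (.const _ p)) (x : E) : E :=
  max 1 ‖x‖ • (H (Set.projIcc 0 1 zero_le_one (2 - 2 * ‖x‖), radialProjection p x) : E)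

variable {p : sphere (0 : E) 1} (H : (ContinuousMap.id (sphere (0 : E) 1)).Homotopy (.const _ p))

theorem nullhomotopyExtension_of_norm_le_half {x : E} (hx : ‖x‖ ≤ 1 / 2) :
    nullhomotopyExtension H x = p := by
  rw [nullhomotopyExtension, Set.projIcc_of_right_le _ (by linarith), max_eq_left (by linarith),
    one_smul]
  exact congrArg Subtype.val (H.apply_one _)

theorem nullhomotopyExtension_of_one_le_norm {x : E} (hx : 1 ≤ ‖x‖) :
    nullhomotopyExtension H x = x := by
  have hx₀ : x ≠ 0 := norm_pos_iff.mp (by linarith)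
  have hzero : H (⟨0, by simp⟩, radialProjection p x) = radialProjection p x := H.apply_zero _
  rw [nullhomotopyExtension, Set.projIcc_of_le_left _ (by linarith), max_eq_right hx, hzero,
    coe_radialProjection p hx₀, norm_smul_normalize]

theorem one_le_norm_nullhomotopyExtension (x : E) : 1 ≤ ‖nullhomotopyExtension H x‖ := by
  rw [nullhomotopyExtension, norm_smul, norm_eq_of_mem_sphere, mul_one]
  exact (le_max_left 1 ‖x‖).trans (le_abs_self _)

theorem continuous_nullhomotopyExtension : Continuous (nullhomotopyExtension H) := by
  refine continuous_iff_continuousAt.mpr fun x => ?_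
  obtain rfl | hx := eq_or_ne x 0
  · refine (continuousAt_const (y := (p : E))).congr ?_
    filter_upwards [closedBall_mem_nhds (0 : E) (one_half_pos (α := ℝ))] with y hy
    exact (nullhomotopyExtension_of_norm_le_half H (mem_closedBall_zero_iff.mp hy)).symm
  · have hproj : ContinuousAt (radialProjection p) x :=
      (continuousOn_radialProjection p).continuousAt (isOpen_compl_singleton.mem_nhds hx)
    have htime : Continuous fun y : E => Set.projIcc (0 : ℝ) 1 zero_le_one (2 - 2 * ‖y‖) :=
      continuous_projIcc.comp (by fun_prop)
    exact (by fun_prop : Continuous fun y : E => max 1 ‖y‖).continuousAt.smul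
      ((continuous_subtype_val.comp H.continuous).continuousAt.comp
        (htime.continuousAt.prodMk hproj))

end

variable {E : Type*} [NormedAddCommGroup E] [InnerProductSpace ℝ E]

theorem not_nullhomotopic_id_sphere [FiniteDimensional ℝ E] :
    ¬ (ContinuousMap.id (sphere (0 : E) 1)).Nullhomotopic := by
  rintro ⟨p, ⟨H⟩⟩
  have hid (x : E) (hx : 1 < ‖x‖) : nullhomotopyExtension H x = x :=
    nullhomotopyExtension_of_one_le_norm H hx.le
  have hopen : IsOpen {x : E | 1 < ‖x‖} := isOpen_lt continuous_const continuous_norm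
  have hclosed : IsClosed {x : E | 2 ≤ ‖x‖} := isClosed_le continuous_const continuous_norm
  have hsub : {x : E | 2 ≤ ‖x‖} ⊆ {x : E | 1 < ‖x‖} :=
    Set.ofPred_subset_ofPred.mpr fun _ => one_lt_two.trans_le
  obtain ⟨g, hg, hdist, hgeq, -⟩ :=
    (continuous_nullhomotopyExtension H).exists_contDiff_approx_and_eqOn (ε := fun _ => 1 / 2) 1
      continuous_const (fun _ => by norm_num) hclosed (hopen.mem_nhdsSet.mpr hsub)
      (contDiff_id.contDiffOn.congr hid)
  have hg₀ (x : E) : g x ≠ 0 := by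
    intro hgx
    have hlt := hdist x
    rw [hgx, dist_zero_left] at hlt
    linarith [one_le_norm_nullhomotopyExtension H x]
  refine not_exists_contDiff_retraction (E := E) two_pos
    ⟨fun x => (2 * ‖g x‖⁻¹) • g x, ?_, fun x => by simp [norm_smul, hg₀ x], fun x hx => ?_⟩
  · exact (contDiff_const.mul ((hg.norm ℝ hg₀).inv fun x => norm_ne_zero_iff.mpr (hg₀ x))).smul hg
  · have hgx : g x = x := (hgeq hx.ge).trans (hid x (by linarith))
    simp [hgx, hx]

variable {X : Type*} [TopologicalSpace X]

theorem nullhomotopic_of_notMem_range (g : C(X, sphere (0 : E) 1)) {q : sphere (0 : E) 1}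
    (hq : q ∉ Set.range g) : g.Nullhomotopic := by
  have hq₁ : ‖(q : E)‖ = 1 := norm_eq_of_mem_sphere q
  let s := stereographic hq₁
  have hmem (x : X) : g x ∈ s.source := by
    rw [stereographic_source]
    exact fun hx => hq ⟨x, hx⟩
  let f : C(X, (ℝ ∙ (q : E))ᗮ) :=
    ⟨fun x => s (g x), s.continuousOn.comp_continuous g.continuous hmem⟩
  let f' : C((ℝ ∙ (q : E))ᗮ, sphere (0 : E) 1) :=
    ⟨s.symm, continuousOn_univ.mp (stereographic_target hq₁ ▸ s.continuousOn_symm)⟩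
  have hg : g = f'.comp f := ContinuousMap.ext fun x => (s.left_inv (hmem x)).symm
  rw [hg]
  exact ((id_nullhomotopic _).comp_left f).comp_right f'

theorem isEmpty_homeomorph_sphere_of_homotopic [FiniteDimensional ℝ E] {g : C(X, X)}
    (hg : (ContinuousMap.id X).Homotopic g) {q : X} (hq : q ∉ Set.range g) :
    IsEmpty (X ≃ₜ sphere (0 : E) 1) := by
  refine ⟨fun e => not_nullhomotopic_id_sphere (E := E) ?_⟩
  let f : C(X, sphere (0 : E) 1) := e
  let f' : C(sphere (0 : E) 1, X) := e.symm
  have hid : (f.comp (.id X)).comp f' = .id _ := ContinuousMap.ext e.apply_symm_apply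
  have hnull : (f.comp g).Nullhomotopic := by
    refine nullhomotopic_of_notMem_range _ (q := e q) ?_
    rintro ⟨x, hx⟩
    exact hq ⟨x, e.injective hx⟩
  obtain ⟨y, hy⟩ := hnull.comp_left f'
  exact ⟨y, hid ▸ ((((ContinuousMap.Homotopic.refl f).comp hg).comp (.refl f')).trans hy)⟩

theorem isEmpty_homeomorph_sphere_of_contractibleSpace [FiniteDimensional ℝ E]
    [ContractibleSpace X] : IsEmpty (X ≃ₜ sphere (0 : E) 1) :=
  ⟨fun e => have := e.symm.contractibleSpace
    not_nullhomotopic_id_sphere (E := E) (id_nullhomotopic _)⟩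

end Sphere

namespace FaceComplex

variable {V : Type*} {Δ : FaceComplex V} {R F : Finset V}

/-- The proper subset `R` of the face `F` is a free face if `F` is the only maximal face that
contains `R`. The complex then collapses onto the subcomplex of the faces that do not contain `R`.
The empty face is free if and only if the complex is a simplex with at least one vertex. -/
structure IsFreeFace (Δ : FaceComplex V) (R F : Finset V) : Prop where
  mem : F ∈ Δ
  ssubset : R ⊂ F
  subset_of_subset : ∀ G ∈ Δ, R ⊆ G → G ⊆ F

variable [DecidableEq V]

theorem IsFreeFace.realization_eq_convexHull (h : Δ.IsFreeFace ∅ F) :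
    Δ.realization = convexHull ℝ ((fun i : V => (Pi.single i 1 : V → ℝ)) '' (F : Set V)) :=
  Set.Subset.antisymm
    (Set.iUnion₂_subset fun I hI =>
      convexHull_mono (Set.image_mono (h.subset_of_subset I hI (Finset.empty_subset I))))
    (Set.subset_iUnion₂_of_subset F h.mem subset_rfl)

/-- The direction in which a free face `R` is pushed towards the vertex `i` outside of `R`. -/
def collapseDirection (R : Finset V) (i : V) : V → ℝ :=
  Pi.single i (R.card : ℝ) - fun j => if j ∈ R then 1 else 0

section

variable {i j : V}

theorem collapseDirection_apply_of_mem (hi : i ∉ R) (hj : j ∈ R) :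
    collapseDirection R i j = -1 := by
  have hji : j ≠ i := fun hji => hi (hji ▸ hj)
  simp [collapseDirection, hj, hji]

theorem collapseDirection_nonneg_of_notMem (hj : j ∉ R) : 0 ≤ collapseDirection R i j := by
  simp only [collapseDirection, Pi.sub_apply, if_neg hj, sub_zero]
  have hsingle : (0 : V → ℝ) ≤ Pi.single i (R.card : ℝ) := Pi.single_nonneg.mpr (Nat.cast_nonneg _)
  exact hsingle j

theorem collapseDirection_eq_zero (hji : j ≠ i) (hj : j ∉ R) : collapseDirection R i j = 0 := by
  simp [collapseDirection, hj, hji]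

variable [Fintype V]

theorem sum_collapseDirection (R : Finset V) (i : V) : ∑ j, collapseDirection R i j = 0 := by
  simp [collapseDirection]

theorem convexHull_image_single (I : Finset V) :
    convexHull ℝ ((fun i : V => (Pi.single i 1 : V → ℝ)) '' (I : Set V)) =
      {x ∈ stdSimplex ℝ V | ∀ j ∉ I, x j = 0} := by
  refine Set.Subset.antisymm (convexHull_min ?_ ?_) ?_
  · rintro _ ⟨i, hi, rfl⟩
    exact ⟨single_mem_stdSimplex ℝ i,
      fun j hj => Pi.single_eq_of_ne (ne_of_mem_of_not_mem hi hj).symm _⟩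
  · refine (convex_stdSimplex ℝ V).inter fun x hx y hy a b _ _ _ j hj => ?_
    simp [hx j hj, hy j hj]
  · rintro x ⟨⟨hnonneg, hsum⟩, hxI⟩
    have hsumI : ∑ j ∈ I, x j = 1 :=
      (Finset.sum_subset (Finset.subset_univ I) fun j _ => hxI j).trans hsum
    have hx : x = ∑ j ∈ I, x j • (Pi.single j 1 : V → ℝ) := by
      ext k
      by_cases hk : k ∈ I <;> simp [Finset.sum_apply, Pi.single_apply, hk, hxI]
    rw [hx]
    exact (convex_convexHull ℝ _).sum_mem (fun j _ => hnonneg j) hsumI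
      fun j hj => subset_convexHull ℝ _ ⟨j, hj, rfl⟩

theorem mem_realization {x : V → ℝ} :
    x ∈ Δ.realization ↔ x ∈ stdSimplex ℝ V ∧ ∃ I ∈ Δ, ∀ j ∉ I, x j = 0 := by
  simp only [realization, convexHull_image_single, Set.mem_iUnion, exists_prop, Set.mem_ofPred_eq]
  tauto

end

section

variable [Finite V] {i : V}

namespace IsFreeFace

theorem add_smul_collapseDirection_mem (h : Δ.IsFreeFace R F) (hiF : i ∈ F) (hiR : i ∉ R)
    {x : V → ℝ} (hx : x ∈ Δ.realization) {s : ℝ} (hs : 0 ≤ s) (hsx : ∀ j ∈ R, s ≤ x j) :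
    x + s • collapseDirection R i ∈ Δ.realization := by
  have := Fintype.ofFinite V
  obtain ⟨⟨hnonneg, hsum⟩, I, hI, hxI⟩ := mem_realization.mp hx
  refine mem_realization.mpr ⟨⟨fun j => ?_, ?_⟩, ?_⟩
  · simp only [Pi.add_apply, Pi.smul_apply, smul_eq_mul]
    by_cases hj : j ∈ R
    · rw [collapseDirection_apply_of_mem hiR hj]
      linarith [hsx j hj]
    · exact add_nonneg (hnonneg j) (mul_nonneg hs (collapseDirection_nonneg_of_notMem hj))
  · simp [Finset.sum_add_distrib, ← Finset.mul_sum, hsum, sum_collapseDirection]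
  · obtain rfl | hs := hs.eq_or_lt
    · exact ⟨I, hI, by simpa using hxI⟩
    · have hRI : R ⊆ I := fun j hj => by
        by_contra hjI
        exact (hs.trans_le (hsx j hj)).ne' (hxI j hjI)
      refine ⟨F, h.mem, fun j hj => ?_⟩
      have hd : collapseDirection R i j = 0 :=
        collapseDirection_eq_zero (ne_of_mem_of_not_mem hiF hj).symm
          fun hjR => hj (h.ssubset.subset hjR)
      simp [hd, hxI j fun hjI => hj (h.subset_of_subset I hI hRI hjI)]

theorem exists_homotopic_notMem_range (h : Δ.IsFreeFace R F) (hR : R.Nonempty) :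
    ∃ g : C(Δ.realization, Δ.realization), (ContinuousMap.id Δ.realization).Homotopic g ∧
      ∃ q, q ∉ Set.range g := by
  have := Fintype.ofFinite V
  obtain ⟨i, hiF, hiR⟩ := Finset.exists_of_ssubset h.ssubset
  let m (x : V → ℝ) : ℝ := R.inf' hR x
  have hm : Continuous m := .finset_inf'_apply hR fun j _ => continuous_apply j
  have hmem (t : unitInterval) (x : Δ.realization) :
      (x : V → ℝ) + ((t : ℝ) * m x) • collapseDirection R i ∈ Δ.realization := by
    have hm₀ : 0 ≤ m x := Finset.le_inf' _ _ fun j _ => (mem_realization.mp x.2).1.1 j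
    exact h.add_smul_collapseDirection_mem hiF hiR x.2 (mul_nonneg t.2.1 hm₀) fun j hj =>
      (mul_le_of_le_one_left hm₀ t.2.2).trans (Finset.inf'_le _ hj)
  let H : C(unitInterval × Δ.realization, Δ.realization) :=
    ⟨fun p => ⟨_, hmem p.1 p.2⟩, by fun_prop⟩
  refine ⟨H.curry 1, ⟨⟨H, fun x => Subtype.ext (by simp [H]), fun _ => rfl⟩⟩, ?_⟩
  have hcard : (R.card : ℝ) ≠ 0 := by exact_mod_cast hR.card_ne_zero
  let q : V → ℝ := fun j => if j ∈ R then (R.card : ℝ)⁻¹ else 0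
  have hq : q ∈ Δ.realization := by
    refine mem_realization.mpr ⟨⟨fun j => ?_, by simp [q, hcard]⟩, F, h.mem, fun j hj => ?_⟩
    · dsimp only [q]
      positivity
    · exact if_neg fun hjR => hj (h.ssubset.subset hjR)
  refine ⟨⟨q, hq⟩, ?_⟩
  rintro ⟨x, hx⟩
  obtain ⟨j, hj, hjm⟩ := R.exists_mem_eq_inf' hR x.1
  have hxj : x.1 j + 1 * m x * collapseDirection R i j = q j := congrFun (congrArg Subtype.val hx) j
  rw [collapseDirection_apply_of_mem hiR hj, show m x = x.1 j from hjm] at hxj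
  exact hcard (by simpa [q, hj] using hxj.symm)

end IsFreeFace

theorem IsSpherical.not_isFreeFace (h : Δ.IsSpherical) : ¬ Δ.IsFreeFace R F := by
  intro hfree
  have := Fintype.ofFinite V
  obtain ⟨-, n, ⟨e⟩⟩ := h
  obtain rfl | hR := R.eq_empty_or_nonempty
  · have : ContractibleSpace Δ.realization := by
      rw [hfree.realization_eq_convexHull]
      exact (convex_convexHull ℝ _).contractibleSpace
        (((Finset.empty_ssubset.mp hfree.ssubset).to_set.image _).convexHull)
    exact isEmpty_homeomorph_sphere_of_contractibleSpace.false e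
  · obtain ⟨g, hg, q, hq⟩ := hfree.exists_homotopic_notMem_range hR
    exact (isEmpty_homeomorph_sphere_of_homotopic hg hq).false e

theorem IsSpherical.isSheddingVertex (h : Δ.IsSpherical) (v : V) : Δ.IsSheddingVertex v := by
  intro J hJ hvJ
  obtain ⟨F, hF, hJF⟩ := exists_isFacet_superset hJ
  by_cases hvF : v ∈ F
  · have hfree : ¬ ∀ G ∈ Δ, F.erase v ⊆ G → G ⊆ F := fun hsub =>
      h.not_isFreeFace ⟨hF.1, Finset.erase_ssubset hvF, hsub⟩
    push Not at hfree
    obtain ⟨G, hG, hFG, hGF⟩ := hfree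
    obtain ⟨F', hF', hGF'⟩ := exists_isFacet_superset hG
    refine ⟨F', hF', (Finset.subset_erase.mpr ⟨hJF, hvJ⟩).trans (hFG.trans hGF'), fun hvF' => ?_⟩
    have hFF' : F ⊆ F' := (Finset.erase_subset_iff_of_mem hvF').mp (hFG.trans hGF')
    exact hGF (hF.eq_of_subset hF'.1 hFF' ▸ hGF')
  · exact ⟨F, hF, hJF, hvF⟩

end

end FaceComplex

theorem mainTheorem7_general {B W : Type*} [Group W] {M : CoxeterMatrix B}
    (cs : CoxeterSystem M W) {r : ℕ} (Q : Fin r → B) (w : W)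
    (h : (cs.subwordComplex Q w).IsSpherical) :
    (∀ i, {i} ∈ cs.subwordComplex Q w →
      ((cs.subwordComplex Q w).deletion {i}).VertexDecomposable) ↔
      (cs.subwordComplex Q w).StronglyVertexDecomposable :=
  ((vertexDecomposable_subwordComplex cs Q w).stronglyVertexDecomposable_iff
    fun i _ => h.isSheddingVertex i).symm

theorem mainTheorem7 :
    (∀ (B : Type u) (W : Type v) [Finite B] [Group W] [Infinite W] (M : CoxeterMatrix B)
        (cs : CoxeterSystem M W) (r : ℕ) (Q : Fin r → B) (w : W),
        (cs.subwordComplex Q w).IsSpherical →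
          ∀ i : Fin r, {i} ∈ cs.subwordComplex Q w →
            ((cs.subwordComplex Q w).deletion {i}).VertexDecomposable) ↔
    (∀ (B : Type u) (W : Type v) [Finite B] [Group W] [Infinite W] (M : CoxeterMatrix B)
        (cs : CoxeterSystem M W) (r : ℕ) (Q : Fin r → B) (w : W),
        (cs.subwordComplex Q w).IsSpherical →
          (cs.subwordComplex Q w).StronglyVertexDecomposable) :=
  ⟨fun h B W _ _ _ M cs r Q w hw => (mainTheorem7_general cs Q w hw).mp (h B W M cs r Q w hw),
    fun h B W _ _ _ M cs r Q w hw => (mainTheorem7_general cs Q w hw).mpr (h B W M cs r Q w hw)⟩
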